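/- Let $M=T^4=(S^1)^{4}$ with angular coordinates $\theta_1,\dots,\theta_4\in\mathbb R/2\pi\mathbb Z$. Let $K=\mathrm{span}(\partial_{\theta_1},\partial_{\theta_2})$ (an involutive distribution, i.e. a foliation of $M$) and choose the complement $G=\mathrm{span}(\partial_{\theta_3},\partial_{\theta_4})$, so that $TM=K\oplus G$ with projections $\mathrm{pr}_K,\mathrm{pr}_G$. Let $W=\Gamma(\wedge K^*\otimes G)[1]$ (so $W_{i}=\Gamma(\wedge^{i+1}K^*\otimes G)$) carry Ji's $L_\infty[1]$-brackets $\lambda_1=l_1$, $\lambda_2=-l_2$, $\lambda_3=l_3$, where, for $X_i\in\Gamma(K)$, $\xi\in\Gamma(\wedge^kK^*\otimes G)$, $\psi\in\Gamma(\wedge^lK^*\otimes G)$, $\phi\in\Gamma(\wedge^mK^*\otimes G)$, $$l_1(\xi)(X_1,\dots,X_{k+1})=\sum_{i}(-1)^{i+1}\mathrm{pr}_G[X_i,\xi(\dots,\hat X_i,\dots)]+\sum_{i<j}(-1)^{i+j}\xi([X_i,X_j],\dots,\hat X_i,\dots,\hat X_j,\dots),$$ $$\begin{aligned}l_2(\xi,\psi)(X_1,\dots,X_{k+l})={}&(-1)^k\sum_{\tau\in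 S_{k,l}}(-1)^\tau\,\mathrm{pr}_G[\xi(X_{\tau(1)},\dots,X_{\tau(k)}),\psi(X_{\tau(k+1)},\dots,X_{\tau(k+l)})]\\&+(-1)^{k(l+1)}I(\xi,\psi)-(-1)^kI(\psi,\xi),\end{aligned}$$ $$I(\xi,\psi)=\sum_{\tau\in S_{l,1,k-1}}(-1)^\tau\,\xi\big(\mathrm{pr}_K[\psi(X_{\tau(1)},\dots,X_{\tau(l)}),X_{\tau(l+1)}],X_{\tau(l+2)},\dots,X_{\tau(l+k)}\big),$$ and $l_3(\xi,\psi,\phi)$ is the sum, over cyclic permutations of $\xi,\psi,\phi$ with Koszul signs for the degrees $k-1,l-1,m-1$, of $$(-1)^{m+k(l+m)}\sum_{\tau\in S_{l,m,k-1}}(-1)^\tau\,\xi\big(\mathrm{pr}_K[\psi(X_{\tau(1)},\dots,X_{\tau(l)}),\phi(X_{\tau(l+1)},\dots,X_{\tau(l+m)})],X_{\tau(l+m+1)},\dots,X_{\tau(l+m+k-1)}\big)$$ (sums are over unshuffles; sums over $S_{\cdot,\cdot,k-1}$ are empty for $k=0$). Put $$\Phi=d\theta_1\otimes\cos(\theta_3)\,\partial_{\theta_4}-d\theta_2\otimes\cos(\theta_4)\,\partial_{\theta_3}\in\Gamma(K^*\otimes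 G)=W_0 .$$ Then: 1. $l_1(\Phi)=0$, and $-l_2(\Phi,\Phi)$ is an $l_1$-closed element of $W_1$. 2. The value $\mathrm{Kr}([\Phi])$ of the Kuranishi map $\mathrm{Kr}:H^0(W)\to H^1(W)$, $[w]\mapsto[-l_2(w,w)]$, does not depend on the closed representative $w$ of $[\Phi]$, equals $[-l_2(\Phi,\Phi)]$, and is non-zero: $-l_2(\Phi,\Phi)\neq l_1(\xi)$ for every $\xi\in\Gamma(K^*\otimes G)$. 3. The class $[\Phi]\in H^0(W)$ is formally obstructed: no closed representative $w$ of $[\Phi]$ extends to a formal curve $\phi_t=tw+t^2\phi_2+t^3\phi_3+\cdots$ ($\phi_n\in W_0$) of Maurer–Cartan elements, i.e. with $l_1(\phi_t)-\tfrac12l_2(\phi_t,\phi_t)+\tfrac16l_3(\phi_t,\phi_t,\phi_t)=0$ in every order of $t$. Hence the deformation problem of the foliation $K$ is formally obstructed, i.e. some class in $H^0(W)$ is formally obstructed in this sense. -/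

import Mathlib

noncomputable section

open scoped Manifold ContDiff

/-! ## Foliations with a complement, and Ji's brackets -/

/-- The block `(X_{τ(off+1)}, …, X_{τ(off+len)})` of the permuted tuple `X`. -/
def permBlock {α : Type*} {n : ℕ} (X : Fin n → α) (τ : Equiv.Perm (Fin n)) (off len : ℕ)
    (h : off + len ≤ n) : Fin len → α :=
  fun i => X (τ ⟨off + i, by omega⟩)

/-- Unshuffles: the permutations of `n` letters that are increasing on every block of consecutive
positions, where new blocks start exactly at the (zero-based) positions in `cuts`. Thus
`S_{i,j,k}` is `unshuffles (i + j + k) {i, i + j}`. -/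
def unshuffles (n : ℕ) (cuts : Finset ℕ) : Finset (Equiv.Perm (Fin n)) :=
  Finset.univ.filter fun τ => ∀ i j : Fin n, i.val + 1 = j.val → j.val ∉ cuts → τ i < τ j

/-- An involutive distribution `K` together with a complement `G`, given through their modules of
sections. Here `A` is the algebra `C^∞(M)` of a manifold `M`, so that `Derivation ℝ A A` is the
Lie algebra and `A`-module of vector fields on `M`, and a decomposition of it into `A`-submodules is
the same as a decomposition `TM = K ⊕ G` into subbundles. Such a `K` is a foliation of `M` when it
is closed under the Lie bracket. -/
structure SplitFoliation (A : Type*) [CommRing A] [Algebra ℝ A] where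
  K : Submodule A (Derivation ℝ A A)
  G : Submodule A (Derivation ℝ A A)
  involutive : ∀ X ∈ K, ∀ Y ∈ K, ⁅X, Y⁆ ∈ K
  isCompl : IsCompl K G

namespace SplitFoliation

variable {A : Type*} [CommRing A] [Algebra ℝ A] (F : SplitFoliation A)

/-- The projection `TM = K ⊕ G → K`. -/
def prK : Derivation ℝ A A →ₗ[A] F.K := F.K.projectionOnto F.G F.isCompl

/-- The projection `TM = K ⊕ G → G`. -/
def prG : Derivation ℝ A A →ₗ[A] F.G := F.G.projectionOnto F.K F.isCompl.symm

/-- The Lie bracket of two sections of `K`. -/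
def lieK (X Y : F.K) : F.K := ⟨⁅X.1, Y.1⁆, F.involutive _ X.2 _ Y.2⟩

/-- `Γ(∧ᵏK* ⊗ G)`: alternating `C^∞(M)`-multilinear maps `Γ(K)ᵏ → Γ(G)`. In the shifted graded
space `W = Γ(∧K* ⊗ G)[1]` this is the component `W_{k-1}`. -/
def Form (k : ℕ) := F.K [⋀^Fin k]→ₗ[A] F.G

instance (k : ℕ) : FunLike (F.Form k) (Fin k → F.K) F.G :=
  inferInstanceAs (FunLike (F.K [⋀^Fin k]→ₗ[A] F.G) (Fin k → F.K) F.G)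

instance (k : ℕ) : AddCommGroup (F.Form k) :=
  inferInstanceAs (AddCommGroup (F.K [⋀^Fin k]→ₗ[A] F.G))

instance (k : ℕ) : Module ℝ (F.Form k) :=
  inferInstanceAs (Module ℝ (F.K [⋀^Fin k]→ₗ[A] F.G))

theorem Form.add_apply {k : ℕ} (ξ η : F.Form k) (X : Fin k → F.K) :
    (ξ + η) X = ξ X + η X := rfl

theorem Form.smul_apply {k : ℕ} (c : ℝ) (ξ : F.Form k) (X : Fin k → F.K) :
    (c • ξ) X = c • ξ X := rfl

/-- The summand `∑_{i<j} (-1)^{i+j} ξ([X_i, X_j], X_1, …, X̂_i, …, X̂_j, …)` of the differential. -/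
def l1Bracket : {k : ℕ} → F.Form k → (Fin (k + 1) → F.K) → F.G
  | 0, _, _ => 0
  | k + 1, ξ, X => ∑ j : Fin (k + 2), ∑ i : Fin (k + 1),
      if i.castSucc < j then
        (-1 : ℤ) ^ (i.val + j.val) •
          ξ (Fin.cons (F.lieK (X i.castSucc) (X j)) (i.removeNth (j.removeNth X)))
      else 0

/-- The differential `l₁(ξ)`, evaluated on `k + 1` sections of `K`. -/
def l1Fun {k : ℕ} (ξ : F.Form k) (X : Fin (k + 1) → F.K) : F.G :=
  ∑ i : Fin (k + 1), (-1 : ℤ) ^ i.val • F.prG ⁅(X i).1, (ξ (i.removeNth X)).1⁆ + F.l1Bracket ξ X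

theorem l1Bracket_add {k : ℕ} (ξ η : F.Form k) :
    F.l1Bracket (ξ + η) = F.l1Bracket ξ + F.l1Bracket η := by
  funext X
  cases k with
  | zero => simp [l1Bracket]
  | succ k =>
    simp only [l1Bracket, Pi.add_apply, ← Finset.sum_add_distrib]
    refine Finset.sum_congr rfl fun j _ => Finset.sum_congr rfl fun i _ => ?_
    split_ifs
    · rw [Form.add_apply, smul_add]
    · simp

theorem l1Bracket_smul {k : ℕ} (c : ℝ) (ξ : F.Form k) :
    F.l1Bracket (c • ξ) = c • F.l1Bracket ξ := by
  funext X
  cases k with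
  | zero => simp [l1Bracket]
  | succ k =>
    simp only [l1Bracket, Pi.smul_apply, Finset.smul_sum]
    refine Finset.sum_congr rfl fun j _ => Finset.sum_congr rfl fun i _ => ?_
    split_ifs
    · rw [Form.smul_apply, smul_comm]
    · simp

/-- The differential `l₁`, as an `ℝ`-linear map. -/
def l1 (k : ℕ) : F.Form k →ₗ[ℝ] ((Fin (k + 1) → F.K) → F.G) where
  toFun := F.l1Fun
  map_add' ξ η := by
    funext X
    simp only [l1Fun, l1Bracket_add, Pi.add_apply, Form.add_apply, Submodule.coe_add,
      lie_add, map_add, smul_add, Finset.sum_add_distrib]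
    abel
  map_smul' c ξ := by
    funext X
    simp only [l1Fun, l1Bracket_smul, Pi.smul_apply, Form.smul_apply,
      Submodule.coe_smul_of_tower, lie_smul, LinearMap.map_smul_of_tower, RingHom.id_apply,
      smul_add, Finset.smul_sum]
    congr 1
    exact Finset.sum_congr rfl fun i _ => smul_comm _ _ _

/-- `∑_{τ ∈ S_{k,l}} (-1)^τ pr_G [ξ(X_{τ(1)}, …, X_{τ(k)}), ψ(X_{τ(k+1)}, …, X_{τ(k+l)})]`. -/
def lieSum {k l n : ℕ} (h : n = k + l) (ξ : F.Form k) (ψ : F.Form l) (X : Fin n → F.K) : F.G :=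
  ∑ τ ∈ unshuffles n {k}, (Equiv.Perm.sign τ : ℤ) •
    F.prG ⁅(ξ (permBlock X τ 0 k (by omega))).1, (ψ (permBlock X τ k l (by omega))).1⁆

/-- `∑_{τ ∈ S_{l,1,k-1}} (-1)^τ
  ξ(pr_K [ψ(X_{τ(1)}, …, X_{τ(l)}), X_{τ(l+1)}], X_{τ(l+2)}, …, X_{τ(l+k)})`;
it is the empty sum for `k = 0`. -/
def insertSum {k l n : ℕ} (h : n = k + l) (ξ : F.Form k) (ψ : F.Form l) (X : Fin n → F.K) : F.G :=
  match k, h, ξ with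
  | 0, _, _ => 0
  | k + 1, h, ξ => ∑ τ ∈ unshuffles n {l, l + 1}, (Equiv.Perm.sign τ : ℤ) •
      ξ (Fin.cons
        (F.prK ⁅(ψ (permBlock X τ 0 l (by omega))).1, (X (τ ⟨l, by omega⟩)).1⁆)
        (permBlock X τ (l + 1) k (by omega)))

/-- The bracket `l₂(ξ, ψ)`, evaluated on `n = k + l` sections of `K`. -/
def l2 {k l n : ℕ} (h : n = k + l) (ξ : F.Form k) (ψ : F.Form l) (X : Fin n → F.K) : F.G :=
  (-1 : ℤ) ^ k • F.lieSum h ξ ψ X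
    + (-1 : ℤ) ^ (k * (l + 1)) • F.insertSum h ξ ψ X
    - (-1 : ℤ) ^ k • F.insertSum (h.trans (Nat.add_comm k l)) ψ ξ X

/-- `(-1)^{m+k(l+m)} ∑_{τ ∈ S_{l,m,k-1}} (-1)^τ ξ(pr_K [ψ(X_{τ(1)}, …, X_{τ(l)}),
  φ(X_{τ(l+1)}, …, X_{τ(l+m)})], X_{τ(l+m+1)}, …, X_{τ(l+m+k-1)})`;
it is the empty sum for `k = 0`. -/
def insertLieSum {k l m n : ℕ} (h : n + 1 = k + l + m) (ξ : F.Form k) (ψ : F.Form l)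
    (φ : F.Form m) (X : Fin n → F.K) : F.G :=
  match k, h, ξ with
  | 0, _, _ => 0
  | k + 1, h, ξ => (-1 : ℤ) ^ (m + (k + 1) * (l + m)) •
      ∑ τ ∈ unshuffles n {l, l + m}, (Equiv.Perm.sign τ : ℤ) •
        ξ (Fin.cons
          (F.prK ⁅(ψ (permBlock X τ 0 l (by omega))).1, (φ (permBlock X τ l m (by omega))).1⁆)
          (permBlock X τ (l + m) k (by omega)))

/-- The bracket `l₃(ξ, ψ, φ)`, evaluated on `n = k + l + m - 1` sections of `K`: the sum of the
above over the cyclic permutations of `ξ, ψ, φ`, with the Koszul signs for the degrees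
`k - 1, l - 1, m - 1` of `ξ, ψ, φ` in `Γ(∧K* ⊗ G)[1]`. -/
def l3 {k l m n : ℕ} (h : n + 1 = k + l + m) (ξ : F.Form k) (ψ : F.Form l) (φ : F.Form m)
    (X : Fin n → F.K) : F.G :=
  F.insertLieSum h ξ ψ φ X
    + (-1 : ℤ) ^ ((k + 1) * (l + m)) • F.insertLieSum (by omega) ψ φ ξ X
    + (-1 : ℤ) ^ ((m + 1) * (k + l)) • F.insertLieSum (by omega) φ ξ ψ X

/-- The `l₁`-closed elements of `Γ(∧ᵏK* ⊗ G)`. -/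
def cocycles (k : ℕ) : Submodule ℝ (F.Form k) := LinearMap.ker (F.l1 k)

/-- The `l₁`-exact elements of `Γ(∧ᵏK* ⊗ G)`. -/
def coboundaries : (k : ℕ) → Submodule ℝ (F.Form k)
  | 0 => ⊥
  | k + 1 =>
    { carrier := {ξ | ∃ η : F.Form k, F.l1 k η = ⇑ξ}
      zero_mem' := ⟨0, by rw [map_zero]; rfl⟩
      add_mem' := by
        rintro ξ ξ' ⟨η, h⟩ ⟨η', h'⟩
        exact ⟨η + η', by rw [map_add, h, h']; rfl⟩
      smul_mem' := by
        rintro c ξ ⟨η, h⟩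
        exact ⟨c • η, by rw [map_smul, h]; rfl⟩ }

/-- The cohomology of `(Γ(∧K* ⊗ G), l₁)` at `Γ(∧ᵏK* ⊗ G)`, that is, `H^{k-1}(W)` for the shifted
complex `W = Γ(∧K* ⊗ G)[1]`. -/
abbrev Cohomology (k : ℕ) : Type _ :=
  F.cocycles k ⧸ (F.coboundaries k).comap (F.cocycles k).subtype

/-- The cohomology class of a closed element. -/
def cls {k : ℕ} (w : F.cocycles k) : F.Cohomology k := Submodule.Quotient.mk w

/-- The Kuranishi map `Kr : H⁰(W) → H¹(W)`, `[w] ↦ [λ₂(w, w)]` with `λ₂ = -l₂`, as a relation: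
`κ` is the class of `-l₂(w, w)` for a closed representative `w` of `c`. -/
def IsKuranishiClass (c : F.Cohomology 1) (κ : F.Cohomology 2) : Prop :=
  ∃ (w : F.cocycles 1) (z : F.cocycles 2),
    F.cls w = c ∧ F.cls z = κ ∧ ⇑z.1 = -F.l2 (n := 2) rfl w.1 w.1

/-- `∑ₙ φₙ tⁿ` with `φ₀ = 0` is a formal curve of Maurer–Cartan elements of
`(Γ(∧K* ⊗ G)[1], l₁, -l₂, l₃)`: every coefficient of
`l₁(φ) + ½ (-l₂)(φ, φ) + ⅙ l₃(φ, φ, φ)` vanishes. -/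
def IsFormalMaurerCartan (φ : ℕ → F.Form 1) : Prop :=
  φ 0 = 0 ∧ ∀ n : ℕ,
    F.l1 1 (φ n)
      + (1 / 2 : ℝ) • ∑ p ∈ Finset.HasAntidiagonal.antidiagonal n, -F.l2 (n := 2) rfl (φ p.1) (φ p.2)
      + (1 / 6 : ℝ) • ∑ p ∈ Finset.HasAntidiagonal.antidiagonal n, ∑ q ∈ Finset.HasAntidiagonal.antidiagonal p.2,
          F.l3 (n := 2) rfl (φ p.1) (φ q.1) (φ q.2) = 0

/-- The class `c ∈ H⁰(W)` is formally obstructed: no closed representative `w` of it extends to a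
formal curve `t w + t² φ₂ + ⋯` of Maurer–Cartan elements. -/
def IsFormallyObstructedClass (c : F.Cohomology 1) : Prop :=
  ∀ w : F.cocycles 1, F.cls w = c → ¬ ∃ φ : ℕ → F.Form 1, F.IsFormalMaurerCartan φ ∧ φ 1 = w.1

/-- Deformations of the foliation `K` are formally obstructed. -/
def FormallyObstructed : Prop := ∃ c : F.Cohomology 1, F.IsFormallyObstructedClass c

end SplitFoliation

/-! ## The four-dimensional torus -/


/-- The manifold `T⁴ = (S¹)⁴`. -/
abbrev Torus4 : Type := Circle × Circle × Circle × Circle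

/-- The model with corners of `T⁴`. -/
abbrev torus4Model := (𝓡 1).prod ((𝓡 1).prod ((𝓡 1).prod (𝓡 1)))

/-- The algebra `C^∞(T⁴)`. -/
def SmoothFn : Type := C^∞⟮torus4Model, Torus4; ℝ⟯

namespace SmoothFn

instance : CommRing SmoothFn := inferInstanceAs (CommRing C^∞⟮torus4Model, Torus4; ℝ⟯)
instance : Algebra ℝ SmoothFn := inferInstanceAs (Algebra ℝ C^∞⟮torus4Model, Torus4; ℝ⟯)
instance : FunLike SmoothFn Torus4 ℝ :=
  inferInstanceAs (FunLike C^∞⟮torus4Model, Torus4; ℝ⟯ Torus4 ℝ)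

/-- A smooth function as an element of `C^∞(T⁴)`. -/
def mk (f : Torus4 → ℝ) (hf : ContMDiff torus4Model 𝓘(ℝ, ℝ) ∞ f) : SmoothFn :=
  (⟨f, hf⟩ : C^∞⟮torus4Model, Torus4; ℝ⟯)

theorem contMDiff (f : SmoothFn) : ContMDiff torus4Model 𝓘(ℝ, ℝ) ∞ f :=
  ContMDiffMap.contMDiff (show C^∞⟮torus4Model, Torus4; ℝ⟯ from f)

@[ext] theorem ext {f g : SmoothFn} (h : ∀ x, f x = g x) : f = g := DFunLike.ext f g h
@[simp] theorem mk_apply (f hf) (x : Torus4) : mk f hf x = f x := rfl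
@[simp] theorem add_apply (f g : SmoothFn) (x : Torus4) : (f + g) x = f x + g x := rfl
@[simp] theorem sub_apply (f g : SmoothFn) (x : Torus4) : (f - g) x = f x - g x := rfl
@[simp] theorem neg_apply (f : SmoothFn) (x : Torus4) : (-f) x = -f x := rfl
@[simp] theorem mul_apply (f g : SmoothFn) (x : Torus4) : (f * g) x = f x * g x := rfl
@[simp] theorem smul_apply (c : ℝ) (f : SmoothFn) (x : Torus4) : (c • f) x = c * f x := rfl
@[simp] theorem zero_apply (x : Torus4) : (0 : SmoothFn) x = 0 := rfl
@[simp] theorem one_apply (x : Torus4) : (1 : SmoothFn) x = 1 := rfl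
@[simp] theorem algebraMap_apply (c : ℝ) (x : Torus4) : algebraMap ℝ SmoothFn c x = c := rfl

end SmoothFn

/-- The `i`-th coordinate `e^{iθ}` of a point of the torus, as an element of the circle. -/
def Torus4.coord (i : Fin 4) (x : Torus4) : Circle := ![x.1, x.2.1, x.2.2.1, x.2.2.2] i

/-- The point of the torus with angular coordinates `θ ∈ ℝ⁴`. -/
def Torus4.exp (θ : Fin 4 → ℝ) : Torus4 :=
  (Circle.exp (θ 0), Circle.exp (θ 1), Circle.exp (θ 2), Circle.exp (θ 3))

theorem Torus4.contMDiff_coord (i : Fin 4) :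
    ContMDiff torus4Model (𝓡 1) ∞ (Torus4.coord i) := by
  fin_cases i
  · exact contMDiff_fst
  · exact contMDiff_fst.comp contMDiff_snd
  · exact contMDiff_fst.comp (contMDiff_snd.comp contMDiff_snd)
  · exact contMDiff_snd.comp (contMDiff_snd.comp contMDiff_snd)

theorem Torus4.contMDiff_exp : ContMDiff 𝓘(ℝ, Fin 4 → ℝ) torus4Model ∞ Torus4.exp := by
  have h : ∀ i : Fin 4, ContMDiff 𝓘(ℝ, Fin 4 → ℝ) (𝓡 1) ∞
      (fun θ : Fin 4 → ℝ => Circle.exp (θ i)) := fun i =>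
    contMDiff_circleExp.comp (contDiff_apply ℝ ℝ i).contMDiff
  exact (h 0).prodMk ((h 1).prodMk ((h 2).prodMk (h 3)))

theorem Torus4.contMDiff_rotate (i : Fin 4) :
    ContMDiff (torus4Model.prod 𝓘(ℝ, ℝ)) torus4Model ∞
      (fun p : Torus4 × ℝ => Torus4.exp (Pi.single i p.2) * p.1) := by
  have h2 : ContMDiff 𝓘(ℝ, ℝ) 𝓘(ℝ, Fin 4 → ℝ) ∞ (fun t : ℝ => (Pi.single i t : Fin 4 → ℝ)) :=
    (ContinuousLinearMap.single ℝ (fun _ : Fin 4 => ℝ) i).contDiff.contMDiff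
  exact ContMDiff.mul ((Torus4.contMDiff_exp.comp h2).comp contMDiff_snd) contMDiff_fst

theorem Torus4.contMDiff_deriv (i : Fin 4) (f : SmoothFn) :
    ContMDiff torus4Model 𝓘(ℝ, ℝ) ∞
      (fun x => deriv (fun t : ℝ => f (Torus4.exp (Pi.single i t) * x)) 0) := by
  intro x₀
  have h := ContMDiffAt.mfderiv_apply (I := 𝓘(ℝ, ℝ)) (I' := 𝓘(ℝ, ℝ)) (J := torus4Model)
    (J' := torus4Model) (n := ∞) (m := ∞) (x₀ := x₀)
    (fun (x : Torus4) (t : ℝ) => f (Torus4.exp (Pi.single i t) * x)) (fun _ => 0) id (fun _ => 1)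
    ((f.contMDiff.comp (Torus4.contMDiff_rotate i)).contMDiffAt) contMDiffAt_const contMDiffAt_id
    contMDiffAt_const (by simp)
  simpa [inTangentCoordinates_model_space, mfderiv_eq_fderiv] using h


theorem Torus4.differentiableAt_rotate (i : Fin 4) (f : SmoothFn) (x : Torus4) (s : ℝ) :
    DifferentiableAt ℝ (fun t : ℝ => f (Torus4.exp (Pi.single i t) * x)) s := by
  have h2 : ContMDiff 𝓘(ℝ, ℝ) 𝓘(ℝ, Fin 4 → ℝ) ∞ (fun t : ℝ => (Pi.single i t : Fin 4 → ℝ)) :=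
    (ContinuousLinearMap.single ℝ (fun _ : Fin 4 => ℝ) i).contDiff.contMDiff
  have h3 : ContMDiff 𝓘(ℝ, ℝ) torus4Model ∞
      (fun t : ℝ => Torus4.exp (Pi.single i t) * x) :=
    (Torus4.contMDiff_exp.comp h2).mul contMDiff_const
  have h : ContMDiff 𝓘(ℝ, ℝ) 𝓘(ℝ, ℝ) ∞ (fun t : ℝ => f (Torus4.exp (Pi.single i t) * x)) :=
    f.contMDiff.comp h3
  exact (h.contDiff.differentiable (by simp)) s

theorem Torus4.exp_zero_mul (i : Fin 4) (x : Torus4) :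
    Torus4.exp (Pi.single i 0) * x = x := by
  simp [Torus4.exp, Prod.ext_iff]

/-- The coordinate vector field `∂/∂θᵢ` on the torus: the derivative of `f` under the rotation of
the `i`-th coordinate. -/
def Torus4.partialDeriv (i : Fin 4) : Derivation ℝ SmoothFn SmoothFn :=
  Derivation.mk'
    { toFun := fun f =>
        SmoothFn.mk (fun x => deriv (fun t : ℝ => f (Torus4.exp (Pi.single i t) * x)) 0)
          (Torus4.contMDiff_deriv i f)
      map_add' := fun f g => by
        ext x
        exact deriv_add (Torus4.differentiableAt_rotate i f x 0)
          (Torus4.differentiableAt_rotate i g x 0)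
      map_smul' := fun c f => by
        ext x
        exact deriv_const_mul c (Torus4.differentiableAt_rotate i f x 0) }
    (fun f g => by
      ext x
      have h := deriv_mul (Torus4.differentiableAt_rotate i f x 0)
        (Torus4.differentiableAt_rotate i g x 0)
      simp only [Torus4.exp_zero_mul] at h
      refine Eq.trans h ?_
      refine (add_comm _ _).trans (congrArg₂ (· + ·) rfl (mul_comm _ _)))

theorem Torus4.partialDeriv_apply (i : Fin 4) (f : SmoothFn) (x : Torus4) :
    Torus4.partialDeriv i f x =
      deriv (fun t : ℝ => f (Torus4.exp (Pi.single i t) * x)) 0 := rfl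

theorem Torus4.contMDiff_coe_coord (i : Fin 4) :
    ContMDiff torus4Model 𝓘(ℝ, ℂ) ∞ (fun x => (Torus4.coord i x : ℂ)) :=
  haveI : Fact (Module.finrank ℝ ℂ = 1 + 1) := Complex.finrank_real_complex_fact
  (contMDiff_coe_sphere (n := 1) (E := ℂ)).comp (Torus4.contMDiff_coord i)

/-- The smooth function `cos θᵢ` on the torus. -/
def Torus4.cosCoord (i : Fin 4) : SmoothFn :=
  SmoothFn.mk (fun x => (Torus4.coord i x : ℂ).re)
    (Complex.reCLM.contDiff.contMDiff.comp (Torus4.contMDiff_coe_coord i))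

/-- The smooth function `sin θᵢ` on the torus. -/
def Torus4.sinCoord (i : Fin 4) : SmoothFn :=
  SmoothFn.mk (fun x => (Torus4.coord i x : ℂ).im)
    (Complex.imCLM.contDiff.contMDiff.comp (Torus4.contMDiff_coe_coord i))

theorem Torus4.cos_sq_add_sin_sq (i : Fin 4) :
    cosCoord i * cosCoord i + sinCoord i * sinCoord i = 1 := by
  ext x
  change (coord i x : ℂ).re * (coord i x : ℂ).re + (coord i x : ℂ).im * (coord i x : ℂ).im = 1
  rw [← Complex.normSq_apply, Complex.normSq_eq_norm_sq, Circle.norm_coe, one_pow]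

theorem Torus4.coord_rotate (i j : Fin 4) (t : ℝ) (x : Torus4) :
    (coord j (exp (Pi.single i t) * x) : ℂ) =
      if i = j then Complex.exp (t * Complex.I) * coord j x else coord j x := by
  fin_cases i <;> fin_cases j <;> simp [coord, exp, Circle.coe_exp]

theorem Torus4.hasDerivAt_coord (j : Fin 4) (x : Torus4) :
    HasDerivAt (fun t : ℝ => Complex.exp (t * Complex.I) * (coord j x : ℂ))
      (Complex.I * coord j x) 0 := by
  have h1 : HasDerivAt (fun t : ℝ => (t : ℂ) * Complex.I) (1 * Complex.I) 0 :=
    (Complex.ofRealCLM.hasDerivAt (x := (0 : ℝ))).mul_const Complex.I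
  simpa using (h1.cexp).mul_const (coord j x : ℂ)

theorem Torus4.partialDeriv_cos (i j : Fin 4) :
    partialDeriv i (cosCoord j) = if i = j then - sinCoord j else 0 := by
  ext x
  rw [partialDeriv_apply]
  change deriv (fun t : ℝ => (coord j (exp (Pi.single i t) * x) : ℂ).re) 0 = _
  simp only [coord_rotate]
  split_ifs with h
  · have := (Complex.reCLM.hasFDerivAt.comp_hasDerivAt (0 : ℝ) (hasDerivAt_coord j x)).deriv
    refine Eq.trans this ?_
    change (Complex.I * (coord j x : ℂ)).re = - (coord j x : ℂ).im
    simp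
  · simp

theorem Torus4.partialDeriv_sin (i j : Fin 4) :
    partialDeriv i (sinCoord j) = if i = j then cosCoord j else 0 := by
  ext x
  rw [partialDeriv_apply]
  change deriv (fun t : ℝ => (coord j (exp (Pi.single i t) * x) : ℂ).im) 0 = _
  simp only [coord_rotate]
  split_ifs with h
  · have := (Complex.imCLM.hasFDerivAt.comp_hasDerivAt (0 : ℝ) (hasDerivAt_coord j x)).deriv
    refine Eq.trans this ?_
    change (Complex.I * (coord j x : ℂ)).im = (coord j x : ℂ).re
    simp
  · simp

/-- Hadamard's lemma on a normed space. -/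
theorem hadamard_lemma {V : Type} [NormedAddCommGroup V] [NormedSpace ℝ V]
    (F : V → ℝ) (hF : ContDiff ℝ ∞ F) (a : V) :
    ∃ H : V → (V →L[ℝ] ℝ), ContDiff ℝ ∞ H ∧ ∀ y, F y = F a + H y (y - a) := by
  let b : ContDiffBump (0 : ℝ) := ⟨2, 3, by norm_num, by norm_num⟩
  let g : V → ℝ → (V →L[ℝ] ℝ) := fun y s => b s • fderiv ℝ F (a + (-s) • (y - a))
  let f : ℝ → ℝ := Set.indicator (Set.Icc 0 1) 1
  have hdF : ContDiff ℝ ∞ (fderiv ℝ F) := hF.fderiv_right (by simp)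
  have hg : ContDiff ℝ ∞ (Function.uncurry g) := by
    have h1 : ContDiff ℝ ∞ (fun p : V × ℝ => b p.2) := b.contDiff.comp contDiff_snd
    have h2 : ContDiff ℝ ∞ (fun p : V × ℝ => a + (-p.2) • (p.1 - a)) := by fun_prop
    exact h1.smul (hdF.comp h2)
  have hf : MeasureTheory.LocallyIntegrable f MeasureTheory.volume := by
    refine MeasureTheory.Integrable.locallyIntegrable ?_
    exact (MeasureTheory.integrable_indicator_iff measurableSet_Icc).2
      (MeasureTheory.integrableOn_const (by simp))
  have key := MeasureTheory.contDiffOn_convolution_right_with_param_comp (n := ⊤) (𝕜 := ℝ)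
    (μ := MeasureTheory.volume) (ContinuousLinearMap.lsmul ℝ ℝ : ℝ →L[ℝ] _ →L[ℝ] (V →L[ℝ] ℝ))
    (v := fun _ : V => (0 : ℝ)) (s := Set.univ) contDiffOn_const (f := f) (g := g)
    (k := Metric.closedBall 0 3) isOpen_univ (isCompact_closedBall 0 3)
    (fun p x _ hx => by
      have : b x = 0 := b.zero_of_le_dist (by
        rw [Metric.mem_closedBall, not_le] at hx
        exact hx.le)
      simp [g, this]) hf hg.contDiffOn
  refine ⟨_, contDiffOn_univ.1 key, fun y => ?_⟩
  have hH : (MeasureTheory.convolution f (g y)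
      (ContinuousLinearMap.lsmul ℝ ℝ : ℝ →L[ℝ] _ →L[ℝ] (V →L[ℝ] ℝ)) MeasureTheory.volume) 0 =
      ∫ t in (0:ℝ)..1, fderiv ℝ F (a + t • (y - a)) := by
    rw [MeasureTheory.convolution_def, intervalIntegral.integral_of_le zero_le_one,
      ← MeasureTheory.integral_Icc_eq_integral_Ioc, ← MeasureTheory.integral_indicator
        measurableSet_Icc]
    refine MeasureTheory.integral_congr_ae (Filter.Eventually.of_forall fun t => ?_)
    by_cases ht : t ∈ Set.Icc (0:ℝ) 1
    · have hb : b (0 - t) = 1 := b.one_of_mem_closedBall (by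
        simp only [Metric.mem_closedBall, dist_zero_right, zero_sub, norm_neg, Real.norm_eq_abs]
        rw [abs_of_nonneg ht.1]; exact ht.2.trans (by norm_num [b]))
      simp only [f, g, Set.indicator_of_mem ht, hb]
      simp
    · simp [f, Set.indicator_of_notMem ht]
  rw [hH]
  have hc : Continuous (fun t : ℝ => fderiv ℝ F (a + t • (y - a))) :=
    hdF.continuous.comp (by fun_prop)
  rw [ContinuousLinearMap.intervalIntegral_apply (hc.intervalIntegrable _ _)]
  have := intervalIntegral.integral_eq_sub_of_hasDerivAt
    (f := fun t : ℝ => F (a + t • (y - a))) (a := 0) (b := 1)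
    (f' := fun t => fderiv ℝ F (a + t • (y - a)) (y - a))
    (fun t _ => by
      have h1 : HasDerivAt (fun t : ℝ => a + t • (y - a)) ((1:ℝ) • (y - a)) t :=
        ((hasDerivAt_id t).smul_const (y - a)).const_add a
      have h2 := ((hF.differentiable (by simp)) (a + t • (y - a))).hasFDerivAt.comp_hasDerivAt t h1
      rw [one_smul] at h2
      exact h2)
    ((hc.clm_apply continuous_const).intervalIntegrable _ _)
  rw [this]; simp

theorem circleExp_arg_contMDiffAt (z : ℂ) (hz : z ≠ 0) :
    ContMDiffAt 𝓘(ℝ, ℂ) (𝓡 1) ∞ (fun w : ℂ => Circle.exp w.arg) z := by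
  have hform : (fun w : ℂ => Circle.exp w.arg) =ᶠ[nhds z]
      fun w => Circle.exp z.arg * Circle.exp (w / z).arg := by
    filter_upwards [isOpen_ne.mem_nhds hz] with w hw
    have hw : w ≠ 0 := hw
    rw [← Circle.exp_add]
    have h := Complex.arg_mul_coe_angle hz (div_ne_zero hw hz)
    rw [mul_div_cancel₀ _ hz] at h
    rw [← Real.Angle.toCircle_coe, ← Real.Angle.toCircle_coe, h, Real.Angle.coe_add]
  refine ContMDiffAt.congr_of_eventuallyEq ?_ hform
  have h1 : ContDiffAt ℝ ∞ (fun w : ℂ => (w / z).arg) z := by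
    have h2 : ContDiffAt ℝ ∞ Complex.log (z / z) := by
      rw [div_self hz]
      exact (Complex.contDiffAt_log (by simp)).restrict_scalars ℝ
    have h3 : ContDiffAt ℝ ∞ (fun w : ℂ => w / z) z := by
      simp only [div_eq_mul_inv]
      exact contDiffAt_id.mul contDiffAt_const
    refine ContDiffAt.congr_of_eventuallyEq ?_ (Filter.Eventually.of_forall fun w =>
      (Complex.log_im (w / z)).symm)
    exact Complex.imCLM.contDiff.contDiffAt.comp (f := fun w : ℂ => Complex.log (w / z)) z
      (ContDiffAt.comp (f := fun w : ℂ => w / z) z h2 h3)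
  exact contMDiffAt_const.mul (contMDiff_circleExp.contMDiffAt.comp z h1.contMDiffAt)

theorem Torus4.exp_arg (x : Torus4) : Torus4.exp (fun i => (coord i x : ℂ).arg) = x := by
  simp [exp, coord, Circle.exp_arg]

theorem Torus4.exists_extension (f : SmoothFn) :
    ∃ F : (Fin 4 → ℂ) → ℝ, ContDiff ℝ ∞ F ∧ ∀ x, F (fun i => (coord i x : ℂ)) = f x := by
  let χ : ℂ → ℝ := fun z => Real.smoothTransition (2 * Complex.normSq z - 1)
  have hχ : ContDiff ℝ ∞ χ := by
    have : ContDiff ℝ ∞ (fun z : ℂ => 2 * (z.re * z.re + z.im * z.im) - 1) := by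
      have h1 : ContDiff ℝ ∞ (fun z : ℂ => z.re) := Complex.reCLM.contDiff
      have h2 : ContDiff ℝ ∞ (fun z : ℂ => z.im) := Complex.imCLM.contDiff
      fun_prop
    exact Real.smoothTransition.contDiff.comp this
  refine ⟨fun z => (∏ i, χ (z i)) * f (exp fun i => (z i).arg), ?_, fun x => ?_⟩
  · rw [contDiff_iff_contDiffAt]
    intro z
    by_cases hz : ∃ i, z i = 0
    · obtain ⟨i, hi⟩ := hz
      have h0 : ∀ᶠ w : Fin 4 → ℂ in nhds z, 2 * Complex.normSq (w i) - 1 < 0 := by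
        have hc : Continuous (fun w : Fin 4 → ℂ => 2 * Complex.normSq (w i) - 1) := by
          have := Complex.continuous_normSq
          fun_prop
        refine hc.continuousAt.eventually_lt continuousAt_const ?_
        simp [hi]
      refine (contDiffAt_const (c := (0:ℝ))).congr_of_eventuallyEq ?_
      filter_upwards [h0] with w hw
      have : ∏ i, χ (w i) = 0 := Finset.prod_eq_zero (Finset.mem_univ i)
        (Real.smoothTransition.zero_of_nonpos hw.le)
      rw [this, zero_mul]
    · push Not at hz
      have h1 : ContDiffAt ℝ ∞ (fun z : Fin 4 → ℂ => ∏ i, χ (z i)) z :=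
        (contDiff_prod fun i _ => hχ.comp (contDiff_apply ℝ ℂ i)).contDiffAt
      have h2 : ∀ i, ContMDiffAt 𝓘(ℝ, Fin 4 → ℂ) (𝓡 1) ∞
          (fun w : Fin 4 → ℂ => Circle.exp (w i).arg) z := fun i =>
        ContMDiffAt.comp (g := fun w : ℂ => Circle.exp w.arg) (f := fun w : Fin 4 → ℂ => w i) z
          (circleExp_arg_contMDiffAt (z i) (hz i)) (contDiff_apply ℝ ℂ i).contMDiff.contMDiffAt
      have h3 : ContMDiffAt 𝓘(ℝ, Fin 4 → ℂ) torus4Model ∞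
          (fun w : Fin 4 → ℂ => exp fun i => (w i).arg) z :=
        (h2 0).prodMk ((h2 1).prodMk ((h2 2).prodMk (h2 3)))
      have h4 : ContMDiffAt 𝓘(ℝ, Fin 4 → ℂ) 𝓘(ℝ, ℝ) ∞
          (fun w : Fin 4 → ℂ => f (exp fun i => (w i).arg)) z :=
        f.contMDiff.contMDiffAt.comp z h3
      exact h1.mul h4.contDiffAt
  · have : ∏ i, χ (coord i x : ℂ) = 1 := Finset.prod_eq_one fun i _ =>
      Real.smoothTransition.one_of_one_le (by
        rw [Complex.normSq_eq_norm_sq, Circle.norm_coe]; norm_num)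
    simp only [this, one_mul, exp_arg]

theorem Torus4.derivation_eq_zero (D : Derivation ℝ SmoothFn SmoothFn)
    (hc : ∀ i, D (cosCoord i) = 0) (hs : ∀ i, D (sinCoord i) = 0) : D = 0 := by
  ext f a
  obtain ⟨F, hF, hFf⟩ := exists_extension f
  obtain ⟨H, hH, hHF⟩ := hadamard_lemma F hF (fun i => (coord i a : ℂ))
  have hsm : ∀ v : Fin 4 → ℂ, ContMDiff torus4Model 𝓘(ℝ, ℝ) ∞
      (fun x => H (fun i => (coord i x : ℂ)) v) := by
    intro v
    have h1 : ContMDiff torus4Model 𝓘(ℝ, Fin 4 → ℂ) ∞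
        (fun x => fun i => (coord i x : ℂ)) :=
      contMDiff_pi_space.2 fun i => contMDiff_coe_coord i
    exact (hH.clm_apply contDiff_const).contMDiff.comp h1
  let P : Fin 4 → SmoothFn := fun i => SmoothFn.mk _ (hsm (Pi.single i 1))
  let Q : Fin 4 → SmoothFn := fun i => SmoothFn.mk _ (hsm (Pi.single i Complex.I))
  let C : ℝ → SmoothFn := algebraMap ℝ SmoothFn
  have hf : f = C (f a) + ∑ i, ((cosCoord i - C (cosCoord i a)) * P i +
      (sinCoord i - C (sinCoord i a)) * Q i) := by
    ext x
    rw [← hFf x, hHF, hFf a]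
    have hv : (fun i => (coord i x : ℂ)) - (fun i => (coord i a : ℂ)) =
        ∑ i, ((cosCoord i x - cosCoord i a) • (Pi.single i 1 : Fin 4 → ℂ) +
          (sinCoord i x - sinCoord i a) • (Pi.single i Complex.I : Fin 4 → ℂ)) := by
      ext j
      simp only [Finset.sum_apply, Pi.add_apply, Pi.smul_apply, Pi.single_apply, Pi.sub_apply]
      simp only [smul_ite, smul_zero, Finset.sum_add_distrib, Finset.sum_ite_eq,
        Finset.mem_univ, if_true]
      apply Complex.ext
      · simp; rfl
      · simp; rfl
    rw [hv]
    simp only [map_add, map_smul, Fin.sum_univ_four, smul_eq_mul]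
    rfl
  have hC : ∀ c, D (C c) = 0 := fun c => D.map_algebraMap c
  have h0 : D f = ∑ i, ((cosCoord i - C (cosCoord i a)) * D (P i) +
      (sinCoord i - C (sinCoord i a)) * D (Q i)) := by
    conv_lhs => rw [hf]
    simp [hC, hc, hs]
  rw [h0]
  simp only [Fin.sum_univ_four]
  change (cosCoord 0 a - cosCoord 0 a) * _ + (sinCoord 0 a - sinCoord 0 a) * _ +
    ((cosCoord 1 a - cosCoord 1 a) * _ + (sinCoord 1 a - sinCoord 1 a) * _) +
    ((cosCoord 2 a - cosCoord 2 a) * _ + (sinCoord 2 a - sinCoord 2 a) * _) +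
    ((cosCoord 3 a - cosCoord 3 a) * _ + (sinCoord 3 a - sinCoord 3 a) * _) = 0
  simp


open Torus4 in
/-- The one-form `dθᵢ = cos θᵢ · d(sin θᵢ) - sin θᵢ · d(cos θᵢ)`. -/
def Torus4.dtheta (i : Fin 4) : Derivation ℝ SmoothFn SmoothFn →ₗ[SmoothFn] SmoothFn where
  toFun X := cosCoord i * X (sinCoord i) - sinCoord i * X (cosCoord i)
  map_add' X Y := by simp only [Derivation.add_apply]; ring
  map_smul' f X := by simp only [Derivation.smul_apply, smul_eq_mul, RingHom.id_apply]; ring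

namespace Torus4

theorem dtheta_partialDeriv (i j : Fin 4) :
    dtheta i (partialDeriv j) = if i = j then 1 else 0 := by
  change cosCoord i * partialDeriv j (sinCoord i) - sinCoord i * partialDeriv j (cosCoord i) = _
  rw [partialDeriv_sin, partialDeriv_cos]
  by_cases h : i = j
  · subst h
    simp only [if_true]
    rw [← cos_sq_add_sin_sq i]; ring
  · simp [h, Ne.symm h]

theorem apply_cosCoord (X : Derivation ℝ SmoothFn SmoothFn) (i : Fin 4) :
    X (cosCoord i) = - (sinCoord i * dtheta i X) := by
  have h := congrArg X (cos_sq_add_sin_sq i)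
  simp only [map_add, Derivation.leibniz, smul_eq_mul, Derivation.map_one_eq_zero] at h
  have h2 : (2 : ℝ) • (cosCoord i * X (cosCoord i) + sinCoord i * X (sinCoord i)) = 0 := by
    rw [two_smul, ← h]; ring
  have h3 := (smul_eq_zero.1 h2).resolve_left two_ne_zero
  change _ = - (sinCoord i * (cosCoord i * X (sinCoord i) - sinCoord i * X (cosCoord i)))
  linear_combination (-X (cosCoord i)) * cos_sq_add_sin_sq i + cosCoord i * h3

theorem apply_sinCoord (X : Derivation ℝ SmoothFn SmoothFn) (i : Fin 4) :
    X (sinCoord i) = cosCoord i * dtheta i X := by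
  have h := congrArg X (cos_sq_add_sin_sq i)
  simp only [map_add, Derivation.leibniz, smul_eq_mul, Derivation.map_one_eq_zero] at h
  have h2 : (2 : ℝ) • (cosCoord i * X (cosCoord i) + sinCoord i * X (sinCoord i)) = 0 := by
    rw [two_smul, ← h]; ring
  have h3 := (smul_eq_zero.1 h2).resolve_left two_ne_zero
  change _ = cosCoord i * (cosCoord i * X (sinCoord i) - sinCoord i * X (cosCoord i))
  linear_combination (-X (sinCoord i)) * cos_sq_add_sin_sq i + sinCoord i * h3

/-- A vector field with vanishing components is zero. -/
theorem eq_zero_of_dtheta (X : Derivation ℝ SmoothFn SmoothFn) (h : ∀ i, dtheta i X = 0) :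
    X = 0 :=
  derivation_eq_zero X (fun i => by rw [apply_cosCoord, h]; simp)
    (fun i => by rw [apply_sinCoord, h]; simp)

/-- The coordinate vector fields are a global frame. -/
theorem eq_sum_dtheta_smul (X : Derivation ℝ SmoothFn SmoothFn) :
    X = ∑ i, dtheta i X • partialDeriv i := by
  rw [← sub_eq_zero]
  refine eq_zero_of_dtheta _ fun j => ?_
  rw [map_sub, map_sum]
  simp [map_smul, dtheta_partialDeriv]

theorem mem_span_pair_iff (i j : Fin 4) (hij : i ≠ j) (X : Derivation ℝ SmoothFn SmoothFn) :
    X ∈ Submodule.span SmoothFn {partialDeriv i, partialDeriv j} ↔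
      ∀ k, k ≠ i → k ≠ j → dtheta k X = 0 := by
  rw [Submodule.mem_span_pair]
  constructor
  · rintro ⟨a, b, rfl⟩ k hi hj
    simp [map_add, map_smul, dtheta_partialDeriv, hi, hj]
  · intro h
    refine ⟨dtheta i X, dtheta j X, ?_⟩
    conv_rhs => rw [eq_sum_dtheta_smul X]
    rw [← Finset.sum_pair (f := fun k => dtheta k X • partialDeriv k) hij]
    refine Finset.sum_subset (Finset.subset_univ _) fun k _ hk => ?_
    simp only [Finset.mem_insert, Finset.mem_singleton, not_or] at hk
    rw [h k hk.1 hk.2, zero_smul]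

/-- The foliation `K = span(∂/∂θ₁, ∂/∂θ₂)` on the torus with the complement
`G = span(∂/∂θ₃, ∂/∂θ₄)`; coordinates are numbered from `0` in the code. -/
def foliation : SplitFoliation SmoothFn where
  K := Submodule.span SmoothFn {partialDeriv 0, partialDeriv 1}
  G := Submodule.span SmoothFn {partialDeriv 2, partialDeriv 3}
  involutive X hX Y hY := by
    rw [mem_span_pair_iff 0 1 (by decide)] at *
    intro k h0 h1
    have hc : ∀ Z : Derivation ℝ SmoothFn SmoothFn, dtheta k Z = 0 →
        Z (cosCoord k) = 0 ∧ Z (sinCoord k) = 0 := fun Z hZ => by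
      rw [apply_cosCoord, apply_sinCoord, hZ]; simp
    have h1 := hc X (hX k h0 h1)
    have h2 := hc Y (hY k h0 ‹_›)
    change cosCoord k * ⁅X, Y⁆ (sinCoord k) - sinCoord k * ⁅X, Y⁆ (cosCoord k) = 0
    simp only [Derivation.commutator_apply, h1.1, h1.2, h2.1, h2.2, map_zero, sub_zero, mul_zero]
  isCompl := by
    refine IsCompl.of_le ?_ ?_
    · rintro X ⟨h1, h2⟩
      have h1 := (mem_span_pair_iff 0 1 (by decide) X).1 h1
      have h2 := (mem_span_pair_iff 2 3 (by decide) X).1 h2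
      refine (Submodule.mem_bot _).2 (eq_zero_of_dtheta X fun i => ?_)
      fin_cases i
      · exact h2 0 (by decide) (by decide)
      · exact h2 1 (by decide) (by decide)
      · exact h1 2 (by decide) (by decide)
      · exact h1 3 (by decide) (by decide)
    · intro X _
      rw [eq_sum_dtheta_smul X, Fin.sum_univ_four, add_assoc]
      exact Submodule.add_mem_sup
        (Submodule.mem_span_pair.2 ⟨_, _, rfl⟩) (Submodule.mem_span_pair.2 ⟨_, _, rfl⟩)

/-- `∂/∂θ₃` as a section of `G`. -/
def e3 : foliation.G := ⟨partialDeriv 2, Submodule.subset_span (by simp)⟩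

/-- `∂/∂θ₄` as a section of `G`. -/
def e4 : foliation.G := ⟨partialDeriv 3, Submodule.subset_span (by simp)⟩

/-- `Φ = dθ₁ ⊗ cos(θ₃) ∂/∂θ₄ - dθ₂ ⊗ cos(θ₄) ∂/∂θ₃ ∈ Γ(K* ⊗ G)`. -/
def Phi : foliation.Form 1 :=
  AlternatingMap.ofSubsingleton SmoothFn foliation.K foliation.G 0
    { toFun := fun X => (dtheta 0 X.1 * cosCoord 2) • e4 - (dtheta 1 X.1 * cosCoord 3) • e3
      map_add' := fun X Y => by
        simp only [Submodule.coe_add, map_add, add_mul, add_smul]; abel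
      map_smul' := fun f X => by
        simp only [Submodule.coe_smul, map_smul, smul_eq_mul, mul_assoc, mul_smul, smul_sub,
          RingHom.id_apply] }

end Torus4

end

noncomputable section

/-! ### Low-degree brackets for an arbitrary split foliation -/

namespace SplitFoliation

variable {A : Type*} [CommRing A] [Algebra ℝ A] (F : SplitFoliation A)

/-! Everything reduces to the commuting frame `∂/∂θ₁, ∂/∂θ₂` of `K`. Write `a, b ∈ Γ(G)` for the
values of a one-form `w` on this frame. Since `K` has rank two, `l₁ w` and `-l₂(w, w)` are multiples
of `dθ₁ ∧ dθ₂` and hence determined by their frame values, which are `[∂₁, b] - [∂₂, a]` and `2[a,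
b]` (`coe_l1_one_frameK`, `coe_l2_one_frameK`); every two-form is closed (`l1_form_two`).

Replacing `w` by a cohomologous form replaces `a, b` by `a + [∂₁, η], b + [∂₂, η]`. The Jacobi
identity and closedness of `w` show that `2[a, b]` then changes by an explicit coboundary
(`lie_add_lie_eq`), so the Kuranishi class is well defined.

For `Φ` the `∂/∂θ₃`-component of `2[a, b]` is `2 cos θ₃ sin θ₄`, which is constant along each leaf
and equal to `2` on the leaf `θ₃ = 0, θ₄ = π/2`. The same component of an exact form is `∂₁f - ∂₂g`,
whose integral over a leaf torus is zero. So the class is non-zero (`l1_ne_l2_Phi`).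

A formal Maurer–Cartan curve starting with `t w` would give, at order `t²`, a primitive of `-l₂(w,
w)` (`IsFormalMaurerCartan.l1_coeff_two`), which is impossible for every representative `w` of
`[Φ]`. -/

theorem Form.zero_apply {k : ℕ} (X : Fin k → F.K) : (0 : F.Form k) X = 0 := rfl

theorem Form.sub_apply {k : ℕ} (ξ η : F.Form k) (X : Fin k → F.K) :
    (ξ - η) X = ξ X - η X := rfl

theorem prG_of_mem {Z : Derivation ℝ A A} (hZ : Z ∈ F.G) : (F.prG Z : Derivation ℝ A A) = Z :=
  congrArg Subtype.val (Submodule.projectionOnto_apply_left F.isCompl.symm ⟨Z, hZ⟩)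

theorem prG_of_mem_K {Z : Derivation ℝ A A} (hZ : Z ∈ F.K) : F.prG Z = 0 :=
  Submodule.projectionOnto_apply_right F.isCompl.symm ⟨Z, hZ⟩

theorem coe_prK_add_coe_prG (Z : Derivation ℝ A A) :
    (F.prK Z : Derivation ℝ A A) + F.prG Z = Z := by
  obtain ⟨X, hX, Y, hY, rfl⟩ := Submodule.mem_sup.1
    (F.isCompl.sup_eq_top ▸ Submodule.mem_top : Z ∈ F.K ⊔ F.G)
  have h1 : F.prK X = ⟨X, hX⟩ := Submodule.projectionOnto_apply_left F.isCompl ⟨X, hX⟩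
  have h2 : F.prK Y = 0 := Submodule.projectionOnto_apply_right F.isCompl ⟨Y, hY⟩
  rw [map_add, map_add, h1, h2, F.prG_of_mem_K hX]
  simp [F.prG_of_mem hY]

theorem unshuffles_two_one : unshuffles 2 {1} = {1, Equiv.swap 0 1} := by decide

/-- For two one-forms the last block of `S_{l,1,k-1}` is empty, so the cut at position `2` lies
outside `Fin 2` and imposes nothing. -/
theorem unshuffles_two_one_two : unshuffles 2 {1, 2} = {1, Equiv.swap 0 1} := by decide

/-- A one-form as a linear map. -/
def Form.toLin (w : F.Form 1) : F.K →ₗ[A] F.G :=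
  (AlternatingMap.ofSubsingleton A F.K F.G (0 : Fin 1)).symm w

theorem Form.apply_eq_toLin (w : F.Form 1) (X : Fin 1 → F.K) : w X = Form.toLin F w (X 0) := by
  have h : X = fun _ => X 0 := funext fun i => by rw [Subsingleton.elim i 0]
  conv_lhs => rw [h]
  rfl

theorem l1_one_apply (w : F.Form 1) (X : Fin 2 → F.K) :
    F.l1 1 w X = F.prG ⁅(X 0).1, (Form.toLin F w (X 1)).1⁆
      - F.prG ⁅(X 1).1, (Form.toLin F w (X 0)).1⁆ - Form.toLin F w (F.lieK (X 0) (X 1)) := by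
  change F.l1Fun w X = _
  simp [l1Fun, l1Bracket, Form.apply_eq_toLin, Fin.sum_univ_two, Fin.removeNth]
  abel

/-- The factor `2` appears twice over: the two unshuffles give equal contributions to the Lie term
by skew-symmetry, and in degree one with equal arguments the two insertion terms carry the same
sign. -/
theorem l2_one_one_apply (w : F.Form 1) (X : Fin 2 → F.K) :
    -F.l2 (n := 2) rfl w w X = (2 : ℤ) • (F.prG ⁅(Form.toLin F w (X 0)).1, (Form.toLin F w (X 1)).1⁆
      - Form.toLin F w (F.prK ⁅(Form.toLin F w (X 0)).1, (X 1).1⁆)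
      + Form.toLin F w (F.prK ⁅(Form.toLin F w (X 1)).1, (X 0).1⁆)) := by
  have hs : F.prG ⁅(Form.toLin F w (X 1)).1, (Form.toLin F w (X 0)).1⁆ =
      -F.prG ⁅(Form.toLin F w (X 0)).1, (Form.toLin F w (X 1)).1⁆ := by
    rw [← map_neg, lie_skew]
  have hne : (1 : Equiv.Perm (Fin 2)) ≠ Equiv.swap 0 1 := by decide
  simp [l2, lieSum, insertSum, unshuffles_two_one, unshuffles_two_one_two, permBlock,
    Form.apply_eq_toLin, Finset.sum_pair hne, hs]
  abel

/-! ### Brackets with a zero argument and the second-order Maurer–Cartan equation -/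

theorem Form.map_cons_zero {k : ℕ} (ξ : F.Form (k + 1)) (X : Fin k → F.K) : ξ (Fin.cons 0 X) = 0 :=
  AlternatingMap.map_coord_zero (f := ξ) 0 rfl

theorem l2_zero_left {k l n : ℕ} (h : n = k + l) (ψ : F.Form l) : F.l2 h 0 ψ = 0 := by
  funext X
  cases k <;> cases l <;> simp [l2, lieSum, insertSum, Form.zero_apply, Form.map_cons_zero]

theorem l2_zero_right {k l n : ℕ} (h : n = k + l) (ξ : F.Form k) : F.l2 h ξ (0 : F.Form l) = 0 := by
  funext X
  cases k <;> cases l <;> simp [l2, lieSum, insertSum, Form.zero_apply, Form.map_cons_zero]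

theorem insertLieSum_zero_left {k l m n : ℕ} (h : n + 1 = k + l + m) (ψ : F.Form l)
    (φ : F.Form m) : F.insertLieSum h 0 ψ φ = 0 := by
  funext X
  cases k <;> simp [insertLieSum, Form.zero_apply]

theorem insertLieSum_zero_mid {k l m n : ℕ} (h : n + 1 = k + l + m) (ξ : F.Form k)
    (φ : F.Form m) : F.insertLieSum h ξ 0 φ = 0 := by
  funext X
  cases k <;> simp [insertLieSum, Form.zero_apply, Form.map_cons_zero]

theorem insertLieSum_zero_right {k l m n : ℕ} (h : n + 1 = k + l + m) (ξ : F.Form k)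
    (ψ : F.Form l) : F.insertLieSum h ξ ψ 0 = 0 := by
  funext X
  cases k <;> simp [insertLieSum, Form.zero_apply, Form.map_cons_zero]

theorem l3_eq_zero {k l m n : ℕ} (h : n + 1 = k + l + m) (ξ : F.Form k) (ψ : F.Form l)
    (φ : F.Form m) (h0 : ξ = 0 ∨ ψ = 0 ∨ φ = 0) : F.l3 h ξ ψ φ = 0 := by
  funext X
  rcases h0 with rfl | rfl | rfl <;>
    simp [l3, insertLieSum_zero_left, insertLieSum_zero_mid, insertLieSum_zero_right]

/-- Because `φ 0 = 0`, the ternary bracket first contributes at order `t³`, and among the binary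
terms of order `t²` only the index pair `(1, 1)` survives. -/
theorem IsFormalMaurerCartan.l1_coeff_two {φ : ℕ → F.Form 1} (h : F.IsFormalMaurerCartan φ) :
    F.l1 1 (φ 2) = (1 / 2 : ℝ) • F.l2 (n := 2) rfl (φ 1) (φ 1) := by
  obtain ⟨h0, h⟩ := h
  have h2 := h 2
  rw [Finset.sum_eq_zero (s := Finset.HasAntidiagonal.antidiagonal 2) (f := fun p =>
    ∑ q ∈ Finset.HasAntidiagonal.antidiagonal p.2, F.l3 (n := 2) rfl (φ p.1) (φ q.1) (φ q.2)),
    smul_zero, add_zero] at h2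
  · simp [Finset.Nat.antidiagonal_succ, h0, l2_zero_left, l2_zero_right] at h2
    rw [one_div]
    exact sub_eq_zero.1 (by rw [sub_eq_add_neg]; exact h2)
  · intro p hp
    refine Finset.sum_eq_zero fun q hq => F.l3_eq_zero _ _ _ _ ?_
    rw [Finset.HasAntidiagonal.mem_antidiagonal] at hp hq
    -- Three natural numbers with sum `2` cannot all be positive.
    have : p.1 = 0 ∨ q.1 = 0 ∨ q.2 = 0 := by omega
    rcases this with h | h | h <;> simp [h, h0]

end SplitFoliation

/-! ### Vector fields on the torus through their components -/

namespace Torus4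

open SplitFoliation

/-- This is closedness of `dθᵢ`. The cross terms of the two Leibniz expansions cancel because `d cos
θᵢ` and `d sin θᵢ` are both multiples of `dθᵢ`. -/
theorem dtheta_lie (i : Fin 4) (X Y : Derivation ℝ SmoothFn SmoothFn) :
    dtheta i ⁅X, Y⁆ = X (dtheta i Y) - Y (dtheta i X) := by
  have h : ∀ Z, dtheta i Z = cosCoord i * Z (sinCoord i) - sinCoord i * Z (cosCoord i) :=
    fun _ => rfl
  rw [h ⁅X, Y⁆, h Y, h X]
  simp only [Derivation.commutator_apply, map_sub, Derivation.leibniz, smul_eq_mul,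
    apply_sinCoord X, apply_sinCoord Y, apply_cosCoord X, apply_cosCoord Y, map_neg]
  ring

theorem lie_partialDeriv (i j : Fin 4) : ⁅partialDeriv i, partialDeriv j⁆ = 0 :=
  eq_zero_of_dtheta _ fun k => by
    rw [dtheta_lie, dtheta_partialDeriv, dtheta_partialDeriv]
    split_ifs <;> simp

theorem ext_dtheta {X Y : Derivation ℝ SmoothFn SmoothFn} (h : ∀ i, dtheta i X = dtheta i Y) :
    X = Y :=
  sub_eq_zero.1 (eq_zero_of_dtheta _ fun i => by rw [map_sub, h, sub_self])

theorem mem_K_iff (X : Derivation ℝ SmoothFn SmoothFn) :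
    X ∈ foliation.K ↔ dtheta 2 X = 0 ∧ dtheta 3 X = 0 := by
  refine (mem_span_pair_iff 0 1 (by decide) X).trans ⟨fun h => ⟨h 2 (by decide) (by decide),
    h 3 (by decide) (by decide)⟩, fun h k h0 h1 => ?_⟩
  fin_cases k
  exacts [absurd rfl h0, absurd rfl h1, h.1, h.2]

theorem mem_G_iff (X : Derivation ℝ SmoothFn SmoothFn) :
    X ∈ foliation.G ↔ dtheta 0 X = 0 ∧ dtheta 1 X = 0 := by
  refine (mem_span_pair_iff 2 3 (by decide) X).trans ⟨fun h => ⟨h 0 (by decide) (by decide),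
    h 1 (by decide) (by decide)⟩, fun h k h0 h1 => ?_⟩
  fin_cases k
  exacts [h.1, h.2, absurd rfl h0, absurd rfl h1]

@[simp] theorem dtheta_two_coe (X : foliation.K) : dtheta 2 X.1 = 0 := ((mem_K_iff _).1 X.2).1
@[simp] theorem dtheta_three_coe (X : foliation.K) : dtheta 3 X.1 = 0 := ((mem_K_iff _).1 X.2).2
@[simp] theorem dtheta_zero_coe (X : foliation.G) : dtheta 0 X.1 = 0 := ((mem_G_iff _).1 X.2).1
@[simp] theorem dtheta_one_coe (X : foliation.G) : dtheta 1 X.1 = 0 := ((mem_G_iff _).1 X.2).2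

theorem ext_K {X Y : foliation.K} (h0 : dtheta 0 X.1 = dtheta 0 Y.1)
    (h1 : dtheta 1 X.1 = dtheta 1 Y.1) : X = Y := by
  refine Subtype.ext (ext_dtheta fun i => ?_)
  have hX := (mem_K_iff _).1 X.2
  have hY := (mem_K_iff _).1 Y.2
  fin_cases i
  exacts [h0, h1, hX.1.trans hY.1.symm, hX.2.trans hY.2.symm]

theorem ext_G {X Y : foliation.G} (h0 : dtheta 2 X.1 = dtheta 2 Y.1)
    (h1 : dtheta 3 X.1 = dtheta 3 Y.1) : X = Y := by
  refine Subtype.ext (ext_dtheta fun i => ?_)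
  have hX := (mem_G_iff _).1 X.2
  have hY := (mem_G_iff _).1 Y.2
  fin_cases i
  exacts [hX.1.trans hY.1.symm, hX.2.trans hY.2.symm, h0, h1]

theorem dtheta_prK_zero (Z : Derivation ℝ SmoothFn SmoothFn) :
    dtheta 0 (foliation.prK Z).1 = dtheta 0 Z := by
  conv_rhs => rw [← foliation.coe_prK_add_coe_prG Z, map_add,
    ((mem_G_iff _).1 (foliation.prG Z).2).1, add_zero]

theorem dtheta_prK_one (Z : Derivation ℝ SmoothFn SmoothFn) :
    dtheta 1 (foliation.prK Z).1 = dtheta 1 Z := by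
  conv_rhs => rw [← foliation.coe_prK_add_coe_prG Z, map_add,
    ((mem_G_iff _).1 (foliation.prG Z).2).2, add_zero]

theorem dtheta_prG_two (Z : Derivation ℝ SmoothFn SmoothFn) :
    dtheta 2 (foliation.prG Z).1 = dtheta 2 Z := by
  conv_rhs => rw [← foliation.coe_prK_add_coe_prG Z, map_add,
    ((mem_K_iff _).1 (foliation.prK Z).2).1, zero_add]

theorem dtheta_prG_three (Z : Derivation ℝ SmoothFn SmoothFn) :
    dtheta 3 (foliation.prG Z).1 = dtheta 3 Z := by
  conv_rhs => rw [← foliation.coe_prK_add_coe_prG Z, map_add,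
    ((mem_K_iff _).1 (foliation.prK Z).2).2, zero_add]

/-! ### Forms and brackets are determined by the frame of `K` -/

/-- The frame `(∂/∂θ₁, ∂/∂θ₂)` of `K`. -/
def frameK (a : Fin 2) : foliation.K :=
  ![⟨partialDeriv 0, Submodule.subset_span (by simp)⟩,
    ⟨partialDeriv 1, Submodule.subset_span (by simp)⟩] a

@[simp] theorem coe_frameK_zero : (frameK 0).1 = partialDeriv 0 := rfl
@[simp] theorem coe_frameK_one : (frameK 1).1 = partialDeriv 1 := rfl

theorem eq_sum_frameK (X : foliation.K) :
    X = dtheta 0 X.1 • frameK 0 + dtheta 1 X.1 • frameK 1 := by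
  apply ext_K <;> simp [dtheta_partialDeriv]

theorem apply_K (X : foliation.K) (f : SmoothFn) :
    X.1 f = dtheta 0 X.1 * partialDeriv 0 f + dtheta 1 X.1 * partialDeriv 1 f := by
  conv_lhs => rw [eq_sum_frameK X]
  simp

/-- `dθ₁ ∧ dθ₂`. -/
def areaForm (X Y : foliation.K) : SmoothFn :=
  dtheta 0 X.1 * dtheta 1 Y.1 - dtheta 0 Y.1 * dtheta 1 X.1

theorem toLin_apply (w : foliation.Form 1) (X : foliation.K) :
    Form.toLin foliation w X = dtheta 0 X.1 • Form.toLin foliation w (frameK 0)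
      + dtheta 1 X.1 • Form.toLin foliation w (frameK 1) := by
  conv_lhs => rw [eq_sum_frameK X]
  simp

/-- `K` has rank two: expand both slots in the frame; the diagonal terms vanish and the mixed ones
combine into the determinant `areaForm`. -/
theorem form_two_apply (z : foliation.Form 2) (X : Fin 2 → foliation.K) :
    z X = areaForm (X 0) (X 1) • z frameK := by
  let f : foliation.K [⋀^Fin 2]→ₗ[SmoothFn] foliation.G := z
  change f X = areaForm (X 0) (X 1) • f frameK
  have hX : X = ![X 0, X 1] := by ext i; fin_cases i <;> rfl
  have hF : frameK = ![frameK 0, frameK 1] := by ext i; fin_cases i <;> rfl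
  have hs : ∀ U V, f ![U, V] = -f ![V, U] := fun U V => by
    rw [← f.map_swap ![V, U] (i := 0) (j := 1) (by decide)]
    congr 1; ext i; fin_cases i <;> rfl
  have hz : ∀ U, f ![U, U] = 0 := fun U =>
    f.map_eq_zero_of_eq _ (i := 0) (j := 1) rfl (by decide)
  have hl : ∀ U V : foliation.K, f ![U, V] =
      dtheta 0 U.1 • f ![frameK 0, V] + dtheta 1 U.1 • f ![frameK 1, V] := fun U V => by
    conv_lhs => rw [eq_sum_frameK U]
    rw [f.map_vecCons_add, f.map_vecCons_smul, f.map_vecCons_smul]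
  rw [hX, hF, hl, hs (frameK 0), hs (frameK 1), hl (X 1), hl (X 1), hz, hz, hs (frameK 1)]
  simp only [Matrix.cons_val_zero, Matrix.cons_val_one, areaForm]
  module

/-- There are no non-zero three-forms on a bundle of rank two. As `l1` takes values in bare
functions of tuples, this is verified by direct expansion of `areaForm ⊗ Z`. -/
theorem l1_form_two (z : foliation.Form 2) : foliation.l1 2 z = 0 := by
  funext X
  change foliation.l1Fun z X = 0
  set Z := z frameK with hZ
  have hz : ∀ Y, z Y = areaForm (Y 0) (Y 1) • Z := form_two_apply z
  have hlk : ∀ U V : foliation.K, (foliation.lieK U V).1 = ⁅U.1, V.1⁆ := fun _ _ => rfl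
  apply ext_G <;>
  · simp [l1Fun, l1Bracket, Fin.sum_univ_three, Fin.sum_univ_two, Fin.removeNth, hz,
      dtheta_prG_two, dtheta_prG_three, dtheta_lie, areaForm, hlk, Fin.succAbove]
    -- Once every derivative along `K` is written with `∂₁` and `∂₂`, the claim is a polynomial
    -- identity.
    simp only [apply_K (X 0), apply_K (X 1), apply_K (X 2)]
    ring

/-- Tensoriality of `l₁ w`: the derivatives of the coefficients of `X 0` and `X 1` cancel against
those in the term with `[X 0, X 1]`. -/
theorem l1_one_eq (w : foliation.Form 1) (X : Fin 2 → foliation.K) :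
    foliation.l1 1 w X = areaForm (X 0) (X 1) • foliation.l1 1 w frameK := by
  have hlk : ∀ U V : foliation.K, (foliation.lieK U V).1 = ⁅U.1, V.1⁆ := fun _ _ => rfl
  rw [l1_one_apply, l1_one_apply]
  simp only [toLin_apply w (X 0), toLin_apply w (X 1), toLin_apply w (foliation.lieK _ _)]
  apply ext_G <;>
  · simp [dtheta_prG_two, dtheta_prG_three, dtheta_lie, hlk, dtheta_partialDeriv, areaForm]
    simp only [apply_K (X 0), apply_K (X 1)]
    ring

/-- Tensoriality again: the derivatives of the coefficients of `X 0`, `X 1` in the Lie term are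
cancelled by the two insertion terms through `pr_K`. -/
theorem l2_one_eq (w : foliation.Form 1) (X : Fin 2 → foliation.K) :
    -foliation.l2 (n := 2) rfl w w X =
      areaForm (X 0) (X 1) • -foliation.l2 (n := 2) rfl w w frameK := by
  rw [l2_one_one_apply, l2_one_one_apply]
  simp only [toLin_apply w (X 0), toLin_apply w (X 1), toLin_apply w (foliation.prK _)]
  apply ext_G <;>
  · simp [dtheta_prG_two, dtheta_prG_three, dtheta_lie, dtheta_prK_zero, dtheta_prK_one,
      dtheta_partialDeriv, areaForm]
    ring
-- Frame values of the brackets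
theorem lie_mem_G {X Y : Derivation ℝ SmoothFn SmoothFn} (hX : X ∈ foliation.G)
    (hY : Y ∈ foliation.G) : ⁅X, Y⁆ ∈ foliation.G := by
  rw [mem_G_iff] at *
  simp [dtheta_lie, hX, hY]

theorem lie_partialDeriv_mem_G {Y : Derivation ℝ SmoothFn SmoothFn} (i : Fin 4)
    (hY : Y ∈ foliation.G) : ⁅partialDeriv i, Y⁆ ∈ foliation.G := by
  rw [mem_G_iff] at *
  -- The components of a coordinate field are the constants `0` and `1`, so derivations kill them;
  -- the arbitrary `c` covers all index conditions at once.
  have h : ∀ c : Prop, [Decidable c] → Y (if c then 1 else 0) = 0 := fun c _ => by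
    split_ifs <;> simp
  simp [dtheta_lie, hY, dtheta_partialDeriv, h]

/-- The components of a one-form in the frame of `K`. -/
def comp (w : foliation.Form 1) (a : Fin 2) : foliation.G := Form.toLin foliation w (frameK a)

theorem coe_l1_one_frameK (w : foliation.Form 1) :
    (foliation.l1 1 w frameK).1 =
      ⁅partialDeriv 0, (comp w 1).1⁆ - ⁅partialDeriv 1, (comp w 0).1⁆ := by
  have h : foliation.lieK (frameK 0) (frameK 1) = 0 := Subtype.ext (lie_partialDeriv 0 1)
  rw [l1_one_apply, h, map_zero, sub_zero, Submodule.coe_sub, coe_frameK_zero, coe_frameK_one,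
    prG_of_mem _ (lie_partialDeriv_mem_G 0 (Subtype.prop _)),
    prG_of_mem _ (lie_partialDeriv_mem_G 1 (Subtype.prop _))]
  rfl

/-- Bracketing with a coordinate field preserves `G`. On the frame this removes the insertion terms
of `l₂` and leaves only the Lie bracket of the components. -/
theorem prK_lie_partialDeriv (i : Fin 4) (Y : foliation.G) :
    foliation.prK ⁅Y.1, partialDeriv i⁆ = 0 := by
  have h := (mem_G_iff _).1 (lie_partialDeriv_mem_G i Y.2)
  rw [← lie_skew, map_neg, neg_eq_zero]
  exact ext_K (by rw [dtheta_prK_zero, h.1]; simp) (by rw [dtheta_prK_one, h.2]; simp)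

theorem coe_l2_one_frameK (w : foliation.Form 1) :
    (-foliation.l2 (n := 2) rfl w w frameK).1 = (2 : ℤ) • ⁅(comp w 0).1, (comp w 1).1⁆ := by
  rw [l2_one_one_apply, coe_frameK_zero, coe_frameK_one, prK_lie_partialDeriv,
    prK_lie_partialDeriv, map_zero, sub_zero, add_zero]
  change (2 : ℤ) • (foliation.prG _).1 = _
  rw [prG_of_mem _ (lie_mem_G (Subtype.prop _) (Subtype.prop _))]
  rfl

theorem coe_l1_zero_apply (η : foliation.Form 0) (X : Fin 1 → foliation.K) :
    foliation.l1 0 η X = foliation.prG ⁅(X 0).1, (η ![]).1⁆ := by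
  change foliation.l1Fun η X = _
  simp [l1Fun, l1Bracket]
  congr
  exact Subsingleton.elim _ _

/-- The one-form with prescribed components in the frame of `K`. -/
def ofComp (g : Fin 2 → foliation.G) : foliation.Form 1 :=
  AlternatingMap.ofSubsingleton SmoothFn foliation.K foliation.G 0
    { toFun := fun X => dtheta 0 X.1 • g 0 + dtheta 1 X.1 • g 1
      map_add' := fun X Y => by
        simp only [Submodule.coe_add, map_add, add_smul]; abel
      map_smul' := fun f X => by
        simp only [Submodule.coe_smul, map_smul, smul_eq_mul, mul_smul, smul_add,
          RingHom.id_apply] }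

theorem comp_ofComp (g : Fin 2 → foliation.G) (a : Fin 2) : comp (ofComp g) a = g a := by
  change dtheta 0 (frameK a).1 • g 0 + dtheta 1 (frameK a).1 • g 1 = g a
  fin_cases a <;> simp [dtheta_partialDeriv]

/-- The two-form with prescribed value on the frame of `K`. -/
def ofFrameValue (Z : foliation.G) : foliation.Form 2 :=
  ({ toFun := fun X => areaForm (X 0) (X 1) • Z
     map_update_add' := fun {inst} X i U V => by
       -- The field quantifies over all decidability instances; passing to the canonical one lets
       -- `Function.update` compute.
       rw [Subsingleton.elim inst (instDecidableEqFin 2), ← add_smul]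
       congr 1
       fin_cases i <;> simp [areaForm] <;> ring
     map_update_smul' := fun {inst} X i f U => by
       rw [Subsingleton.elim inst (instDecidableEqFin 2), smul_smul]
       congr 1
       fin_cases i <;> simp [areaForm] <;> ring
     map_eq_zero_of_eq' := fun X i j h hij => by
       have h01 : X 0 = X 1 := by
         fin_cases i <;> fin_cases j <;> simp_all
       rw [h01, areaForm, sub_self, zero_smul] } :
    foliation.K [⋀^Fin 2]→ₗ[SmoothFn] foliation.G)

theorem ofFrameValue_apply (Z : foliation.G) (X : Fin 2 → foliation.K) :
    ofFrameValue Z X = areaForm (X 0) (X 1) • Z := rfl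

/-- Both sides are multiples of `areaForm`, so exactness may be tested on the frame alone. -/
theorem coe_form_two_eq_l1 {z : foliation.Form 2} {ξ : foliation.Form 1}
    (h : foliation.l1 1 ξ frameK = z frameK) : foliation.l1 1 ξ = ⇑z := by
  funext X
  rw [l1_one_eq, h, form_two_apply z X]

theorem mem_coboundaries_two_iff (z : foliation.Form 2) :
    z ∈ foliation.coboundaries 2 ↔ ∃ ξ, foliation.l1 1 ξ frameK = z frameK :=
  ⟨fun ⟨ξ, h⟩ => ⟨ξ, congrFun h _⟩, fun ⟨ξ, h⟩ => ⟨ξ, coe_form_two_eq_l1 h⟩⟩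

/-- The Kuranishi form is a two-form. -/
theorem coe_ofFrameValue_l2 (w : foliation.Form 1) :
    ⇑(ofFrameValue (-foliation.l2 (n := 2) rfl w w frameK)) =
      -foliation.l2 (n := 2) rfl w w := by
  funext X
  rw [ofFrameValue_apply]
  exact (l2_one_eq w X).symm

/-! ### Independence of the Kuranishi class from the representative -/

theorem comp_eq_add_of_cohomologous {w w' : foliation.cocycles 1}
    (h : foliation.cls w' = foliation.cls w) :
    ∃ η : foliation.G, (comp w'.1 0).1 = (comp w.1 0).1 + ⁅partialDeriv 0, η.1⁆ ∧
      (comp w'.1 1).1 = (comp w.1 1).1 + ⁅partialDeriv 1, η.1⁆ := by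
  have h1 : w' - w ∈ (foliation.coboundaries 1).comap (foliation.cocycles 1).subtype :=
    (Submodule.Quotient.eq _).1 h
  obtain ⟨η, hη⟩ := h1
  have key : ∀ a, (comp w'.1 a).1 = (comp w.1 a).1 + (foliation.prG ⁅(frameK a).1, (η ![]).1⁆).1 :=
    fun a => by
      have h2 := congrFun hη (fun _ => frameK a)
      rw [coe_l1_zero_apply] at h2
      rw [h2]
      change _ = _ + ((w'.1 - w.1) (fun _ => frameK a)).1
      rw [Form.sub_apply, Form.apply_eq_toLin, Form.apply_eq_toLin]
      simp [comp]
  refine ⟨η ![], ?_, ?_⟩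
  · rw [key 0, coe_frameK_zero, prG_of_mem _ (lie_partialDeriv_mem_G 0 (Subtype.prop _))]
  · rw [key 1, coe_frameK_one, prG_of_mem _ (lie_partialDeriv_mem_G 1 (Subtype.prop _))]

/-- A pure Lie ring identity, with `x, y` in the role of `∂₁, ∂₂` and `hc` in the role of
closedness. By Jacobi, the `2[η, ·]` terms produce the part linear in `η`, where `hc` cancels the
leftovers; the `[η, [·, η]]` terms produce `2[[x, η], [y, η]]` since `ad x` and `ad y` commute. -/
theorem lie_add_lie_eq {L : Type*} [LieRing L] (x y a b η : L) (hxy : ⁅x, y⁆ = 0)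
    (hc : ⁅x, b⁆ = ⁅y, a⁆) :
    (2 : ℤ) • ⁅a + ⁅x, η⁆, b + ⁅y, η⁆⁆ = (2 : ℤ) • ⁅a, b⁆ +
      (⁅x, (2 : ℤ) • ⁅η, b⁆ + ⁅η, ⁅y, η⁆⁆⁆ - ⁅y, (2 : ℤ) • ⁅η, a⁆ + ⁅η, ⁅x, η⁆⁆⁆) := by
  have hcomm : ⁅y, ⁅x, η⁆⁆ = ⁅x, ⁅y, η⁆⁆ := by
    rw [leibniz_lie x y η, hxy, zero_lie, zero_add]
  simp only [lie_add, add_lie, lie_zsmul, leibniz_lie x η, leibniz_lie y η, hcomm, hc]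
  rw [← lie_skew ⁅x, η⁆ ⁅y, η⁆, ← lie_skew a ⁅y, η⁆]
  abel

/-- The Kuranishi form changes by a coboundary within a cohomology class. -/
theorem exists_l2_eq_add_l1 {w w' : foliation.cocycles 1}
    (h : foliation.cls w' = foliation.cls w) :
    ∃ ξ, -foliation.l2 (n := 2) rfl w'.1 w'.1 frameK =
      -foliation.l2 (n := 2) rfl w.1 w.1 frameK + foliation.l1 1 ξ frameK := by
  obtain ⟨η, h0, h1⟩ := comp_eq_add_of_cohomologous h
  have hc : ⁅partialDeriv 0, (comp w.1 1).1⁆ = ⁅partialDeriv 1, (comp w.1 0).1⁆ := by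
    rw [← sub_eq_zero, ← coe_l1_one_frameK, LinearMap.mem_ker.1 w.2]
    rfl
  -- The components of the primitive are read off from the right-hand side of `lie_add_lie_eq`.
  refine ⟨ofComp ![⟨(2 : ℤ) • ⁅η.1, (comp w.1 0).1⁆ + ⁅η.1, ⁅partialDeriv 0, η.1⁆⁆,
      add_mem (zsmul_mem (lie_mem_G η.2 (Subtype.prop _)) 2)
        (lie_mem_G η.2 (lie_partialDeriv_mem_G 0 η.2))⟩,
    ⟨(2 : ℤ) • ⁅η.1, (comp w.1 1).1⁆ + ⁅η.1, ⁅partialDeriv 1, η.1⁆⁆,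
      add_mem (zsmul_mem (lie_mem_G η.2 (Subtype.prop _)) 2)
        (lie_mem_G η.2 (lie_partialDeriv_mem_G 1 η.2))⟩], Subtype.ext ?_⟩
  rw [Submodule.coe_add, coe_l2_one_frameK, coe_l2_one_frameK, coe_l1_one_frameK, comp_ofComp,
    comp_ofComp, h0, h1]
  exact lie_add_lie_eq _ _ _ _ _ (lie_partialDeriv 0 1) hc

/-! ### The form `Φ` -/

theorem comp_Phi_zero : (comp Phi 0).1 = cosCoord 2 • partialDeriv 3 := by
  change (dtheta 0 (frameK 0).1 * cosCoord 2) • partialDeriv 3 -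
    (dtheta 1 (frameK 0).1 * cosCoord 3) • partialDeriv 2 = _
  simp [dtheta_partialDeriv]

theorem comp_Phi_one : (comp Phi 1).1 = -(cosCoord 3 • partialDeriv 2) := by
  change (dtheta 0 (frameK 1).1 * cosCoord 2) • partialDeriv 3 -
    (dtheta 1 (frameK 1).1 * cosCoord 3) • partialDeriv 2 = _
  simp [dtheta_partialDeriv]

/-- The components of `Φ` do not depend on `θ₁, θ₂`, so they commute with the frame of `K`. -/
theorem l1_Phi : foliation.l1 1 Phi = 0 := by
  funext X
  rw [l1_one_eq]
  have : foliation.l1 1 Phi frameK = 0 := by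
    refine Subtype.ext ?_
    rw [coe_l1_one_frameK, comp_Phi_zero, comp_Phi_one]
    refine ext_dtheta fun i => ?_
    fin_cases i <;> simp [dtheta_lie, dtheta_partialDeriv, partialDeriv_cos]
  rw [this, smul_zero]; rfl

/-- One component suffices to detect non-exactness; this one comes from `cos θ₃ ∂₄` differentiating
`-cos θ₄`. -/
theorem dtheta_two_l2_Phi :
    dtheta 2 (-foliation.l2 (n := 2) rfl Phi Phi frameK).1 =
      (2 : ℝ) • (cosCoord 2 * sinCoord 3) := by
  rw [coe_l2_one_frameK, comp_Phi_zero, comp_Phi_one, map_zsmul, dtheta_lie, two_smul, two_smul]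
  simp [dtheta_partialDeriv, partialDeriv_cos]

/-! ### Integration over the leaves -/

theorem exp_add (θ θ' : Fin 4 → ℝ) : exp (θ + θ') = exp θ * exp θ' := by
  simp [exp, Circle.exp_add]

/-- `partialDeriv` is defined by a derivative at `0`; the group law of the torus carries it to an
arbitrary time `s`. -/
theorem hasDerivAt_rotate (i : Fin 4) (f : SmoothFn) (x : Torus4) (s : ℝ) :
    HasDerivAt (fun t : ℝ => f (exp (Pi.single i t) * x))
      (partialDeriv i f (exp (Pi.single i s) * x)) s := by
  have h := (differentiableAt_rotate i f (exp (Pi.single i s) * x) 0).hasDerivAt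
  rw [← partialDeriv_apply] at h
  have h2 := HasDerivAt.comp_sub_const (x := s) (a := s)
    (f := fun t : ℝ => f (exp (Pi.single i t) * (exp (Pi.single i s) * x))) (by rwa [sub_self])
  refine h2.congr_of_eventuallyEq (Filter.Eventually.of_forall fun t => ?_)
  simp only [← mul_assoc, ← exp_add, ← Pi.single_add, sub_add_cancel]

theorem continuous_rotate (i : Fin 4) (f : SmoothFn) (x : Torus4) :
    Continuous (fun t : ℝ => f (exp (Pi.single i t) * x)) :=
  continuous_iff_continuousAt.2 fun s => (hasDerivAt_rotate i f x s).continuousAt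

theorem exp_single_two_pi (i : Fin 4) : exp (Pi.single i (2 * Real.pi)) = 1 := by
  fin_cases i <;> simp [exp, Prod.ext_iff]

/-- The fundamental theorem of calculus on a closed orbit: rotation by `2π` is the identity. -/
theorem integral_partialDeriv_rotate (i : Fin 4) (f : SmoothFn) (x : Torus4) :
    ∫ t in (0 : ℝ)..(2 * Real.pi), partialDeriv i f (exp (Pi.single i t) * x) = 0 := by
  rw [intervalIntegral.integral_eq_sub_of_hasDerivAt (fun t _ => hasDerivAt_rotate i f x t)
    ((continuous_rotate i _ x).intervalIntegrable _ _), exp_single_two_pi, exp_zero_mul, one_mul,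
    sub_self]

theorem continuous_exp : Continuous exp := contMDiff_exp.continuous

/-- A difference `∂f/∂θ₁ - ∂g/∂θ₂` that is constant along a leaf vanishes there. -/
theorem eq_zero_of_partialDeriv_sub_eq (f g : SmoothFn) (x : Torus4) (c : ℝ)
    (h : ∀ s t : ℝ, partialDeriv 0 f (exp (Pi.single 0 s) * (exp (Pi.single 1 t) * x)) -
      partialDeriv 1 g (exp (Pi.single 0 s) * (exp (Pi.single 1 t) * x)) = c) : c = 0 := by
  have hcomm : ∀ s t : ℝ, exp (Pi.single 0 s) * (exp (Pi.single 1 t) * x) =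
      exp (Pi.single 1 t) * (exp (Pi.single 0 s) * x) := fun s t => by
    rw [← mul_assoc, mul_comm (exp _), mul_assoc]
  have hcont : ∀ u : SmoothFn, Continuous
      (fun p : ℝ × ℝ => u (exp (Pi.single 0 p.2) * (exp (Pi.single 1 p.1) * x))) := fun u => by
    have he : ∀ i, Continuous (fun t : ℝ => exp (Pi.single i t)) := fun i =>
      continuous_exp.comp (ContinuousLinearMap.single ℝ (fun _ : Fin 4 => ℝ) i).continuous
    have hu : Continuous u := u.contMDiff.continuous
    exact hu.comp (((he 0).comp continuous_snd).mul (
      ((he 1).comp continuous_fst).mul continuous_const))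
  have hc2 : Continuous (Function.uncurry fun t s : ℝ =>
      partialDeriv 1 g (exp (Pi.single 0 s) * (exp (Pi.single 1 t) * x))) :=
    hcont (partialDeriv 1 g)
  -- Here the inner variable is `s` but the derivative is in the `t` direction, so Fubini and
  -- commutativity of the rotations are needed before the orbit integral vanishes.
  have hg : ∫ t in (0 : ℝ)..(2 * Real.pi), ∫ s in (0 : ℝ)..(2 * Real.pi),
      partialDeriv 1 g (exp (Pi.single 0 s) * (exp (Pi.single 1 t) * x)) = 0 := by
    refine (MeasureTheory.intervalIntegral_intervalIntegral_swap
      ((hc2.continuousOn.integrableOn_compact (isCompact_uIcc.prod isCompact_uIcc)).mono_set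
        (Set.prod_mono Set.uIoc_subset_uIcc Set.uIoc_subset_uIcc))).trans ?_
    simp_rw [hcomm, integral_partialDeriv_rotate, intervalIntegral.integral_zero]
  have hfg : ∫ t in (0 : ℝ)..(2 * Real.pi), ∫ s in (0 : ℝ)..(2 * Real.pi),
      (partialDeriv 0 f (exp (Pi.single 0 s) * (exp (Pi.single 1 t) * x)) -
        partialDeriv 1 g (exp (Pi.single 0 s) * (exp (Pi.single 1 t) * x))) = 0 := by
    simp_rw [intervalIntegral.integral_sub ((continuous_rotate 0 _ _).intervalIntegrable _ _)
      ((continuous_rotate 0 _ _).intervalIntegrable _ _), integral_partialDeriv_rotate, zero_sub,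
      intervalIntegral.integral_neg, hg, neg_zero]
  simp only [h] at hfg
  -- The integral of the constant is `(2π)² c`.
  simpa using hfg

/-- The Kuranishi form of `Φ` is not exact. -/
theorem l1_ne_l2_Phi (ξ : foliation.Form 1) :
    foliation.l1 1 ξ frameK ≠ -foliation.l2 (n := 2) rfl Phi Phi frameK := by
  intro h
  have h2 := congrArg (fun Z : foliation.G => dtheta 2 Z.1) h
  simp only [dtheta_two_l2_Phi, coe_l1_one_frameK, map_sub, dtheta_lie, dtheta_partialDeriv] at h2
  simp at h2
  -- The base point has `θ₃ = 0` and `θ₄ = π/2`, so `2 cos θ₃ sin θ₄` is constantly `2` on its leaf.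
  refine two_ne_zero (α := ℝ) (eq_zero_of_partialDeriv_sub_eq (dtheta 2 (comp ξ 1).1)
    (dtheta 2 (comp ξ 0).1) (exp (Pi.single 3 (Real.pi / 2))) 2 fun s t => ?_)
  have h3 := congrArg (fun u : SmoothFn =>
    u (exp (Pi.single 0 s) * (exp (Pi.single 1 t) * exp (Pi.single 3 (Real.pi / 2))))) h2
  refine h3.trans ?_
  have hc : ∀ i y, cosCoord i y = (coord i y : ℂ).re := fun _ _ => rfl
  have hs : ∀ i y, sinCoord i y = (coord i y : ℂ).im := fun _ _ => rfl
  simp only [SmoothFn.smul_apply, SmoothFn.mul_apply, hc, hs, coord_rotate]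
  simp [coord, exp, Circle.coe_exp]

/-! ### Obstruction for every representative, and the conclusion -/

/-- A primitive for one representative, corrected by the coboundary relating the two Kuranishi
forms, would be a primitive for `Φ` itself. -/
theorem not_exists_l1_eq_of_cls_eq {w w' : foliation.cocycles 1} (hw : w.1 = Phi)
    (h : foliation.cls w' = foliation.cls w) (ξ : foliation.Form 1) :
    foliation.l1 1 ξ frameK ≠ -foliation.l2 (n := 2) rfl w'.1 w'.1 frameK := by
  intro hξ
  obtain ⟨ζ, hζ⟩ := exists_l2_eq_add_l1 h
  refine l1_ne_l2_Phi (ξ - ζ) ?_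
  rw [map_sub, Pi.sub_apply, hξ, hζ, hw, add_sub_cancel_right]

end Torus4

/-- On `T⁴`, for the foliation `K = span(∂/∂θ₁, ∂/∂θ₂)` with complement `G = span(∂/∂θ₃, ∂/∂θ₄)`:
`Φ` is `l₁`-closed, `-l₂(Φ, Φ)` is an `l₁`-closed element of `Γ(∧²K* ⊗ G)`, its class is
`Kr([Φ])` and does not vanish; the class `[Φ]` is formally obstructed, so deformations of `K` are
formally obstructed. -/
theorem mainTheorem11 :
    ∃ (w : Torus4.foliation.cocycles 1) (z : Torus4.foliation.cocycles 2),
      w.1 = Torus4.Phi ∧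
      ⇑z.1 = -Torus4.foliation.l2 (n := 2) rfl Torus4.Phi Torus4.Phi ∧
      (∀ κ, Torus4.foliation.IsKuranishiClass (Torus4.foliation.cls w) κ ↔
        κ = Torus4.foliation.cls z) ∧
      Torus4.foliation.cls z ≠ 0 ∧
      Torus4.foliation.IsFormallyObstructedClass (Torus4.foliation.cls w) ∧
      Torus4.foliation.FormallyObstructed := by
  let w : Torus4.foliation.cocycles 1 := ⟨Torus4.Phi, LinearMap.mem_ker.2 Torus4.l1_Phi⟩
  -- `l2` yields a bare function, so the two-form is rebuilt from its frame value; its closedness is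
  -- automatic in rank two.
  let z : Torus4.foliation.cocycles 2 := ⟨_, LinearMap.mem_ker.2 (Torus4.l1_form_two
    (Torus4.ofFrameValue (-Torus4.foliation.l2 (n := 2) rfl Torus4.Phi Torus4.Phi Torus4.frameK)))⟩
  have hz : ⇑z.1 = -Torus4.foliation.l2 (n := 2) rfl Torus4.Phi Torus4.Phi :=
    Torus4.coe_ofFrameValue_l2 Torus4.Phi
  have hobs : Torus4.foliation.IsFormallyObstructedClass (Torus4.foliation.cls w) := by
    rintro w' hw' ⟨φ, hφ, hφ1⟩
    have h2 := hφ.l1_coeff_two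
    rw [hφ1] at h2
    -- The second-order equation reads `l₁ φ₂ = ½ l₂(w', w')`, so `-2 φ₂` is a primitive of `-l₂(w',
    -- w')`.
    refine Torus4.not_exists_l1_eq_of_cls_eq rfl hw' ((-2 : ℝ) • φ 2) ?_
    rw [map_smul, h2, smul_smul]
    norm_num
  refine ⟨w, z, rfl, hz, fun κ => ⟨?_, ?_⟩, fun h0 => ?_, hobs, _, hobs⟩
  · rintro ⟨w', z', hw', rfl, hz'⟩
    obtain ⟨ξ, hξ⟩ := Torus4.exists_l2_eq_add_l1 hw'
    refine (Submodule.Quotient.eq _).2 (Submodule.mem_comap.2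
      ((Torus4.mem_coboundaries_two_iff _).2 ⟨ξ, ?_⟩))
    change _ = z'.1 Torus4.frameK - z.1 Torus4.frameK
    rw [hz', hz, Pi.neg_apply, hξ]
    exact (add_sub_cancel_left _ _).symm
  · rintro rfl
    exact ⟨w, z, rfl, rfl, hz⟩
  · obtain ⟨ξ, hξ⟩ := (Torus4.mem_coboundaries_two_iff _).1
      (Submodule.mem_comap.1 ((Submodule.Quotient.mk_eq_zero _).1 h0))
    exact Torus4.l1_ne_l2_Phi ξ (hξ.trans (congrFun hz _))

end
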